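/- **Corollary (Algebraic Consequences).** An instance $I=(A,B,k)$ of the Nested Polytope Problem consists of a dimension $n$, two convex polytopes $A\subseteq B\subset\mathbb{R}^n$ with rational data (the inner polytope $A$ is given by its finitely many vertices, which lie in $\mathbb{Q}^n$; the outer polytope $B$ is the bounded solution set of finitely many linear inequalities with rational coefficients) and a number $k\in\mathbb{N}$. A solution of $I$ is a $k$-tuple $(x_1,\ldots,x_k)$ of points of $\mathbb{R}^n$ with $$A\subseteq \operatorname{conv}(x_1,\ldots,x_k)\subseteq B .$$ Let $\mathbb{Q}\subseteq F_1\subsetneq F_2\subset\mathbb{R}$ be fields, both algebraic over $\mathbb{Q}$. Then there exists an instance of the Nested Polytope Problem that has a solution all of whose coordinates lie in $F_2$, but that has no solution all of whose coordinates lie in $F_1$. -/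

import Mathlib

/-- The real point with the given rational coordinates. -/
def ratPoint {n : ℕ} (v : Fin n → ℚ) : Fin n → ℝ := fun i => (v i : ℝ)

/-- The convex hull in `ℝⁿ` of a finite set of rational points. -/
def hullOfPoints {n : ℕ} (S : Finset (Fin n → ℚ)) : Set (Fin n → ℝ) :=
  convexHull ℝ (ratPoint '' (S : Set (Fin n → ℚ)))

/-- The set of real solutions of finitely many linear inequalities `⟨a, x⟩ ≤ b` with rational
coefficients, an inequality being stored as the pair `(a, b)`. A linear equation is written as
two opposite inequalities. -/
def solutionsOfInequalities {n : ℕ} (H : Finset ((Fin n → ℚ) × ℚ)) : Set (Fin n → ℝ) :=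
  {x | ∀ h ∈ H, ∑ i, (h.1 i : ℝ) * x i ≤ (h.2 : ℝ)}

/-- An instance `(A, B, k)` of the Nested Polytope Problem: an inner polytope `A`, given by its
vertices, an outer polytope `B` containing it, given by linear inequalities (all with rational
data), and the number `k` of vertices allowed for a nested polytope. -/
structure NestedPolytopeInstance where
  /-- dimension of the ambient space `ℝⁿ` -/
  n : ℕ
  /-- the vertices of the inner polytope -/
  innerVertices : Finset (Fin n → ℚ)
  /-- the inequalities that describe the outer polytope -/
  outerInequalities : Finset ((Fin n → ℚ) × ℚ)
  /-- the number of vertices of the polytope that is sought -/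
  k : ℕ
  /-- each listed point really is a vertex of the inner polytope -/
  inner_vertex : ∀ v ∈ innerVertices, ratPoint v ∉ hullOfPoints (innerVertices.erase v)
  /-- the outer polyhedron is bounded, hence a polytope -/
  outer_bounded : Bornology.IsBounded (solutionsOfInequalities outerInequalities)
  /-- the inner polytope lies in the outer one -/
  inner_subset_outer : hullOfPoints innerVertices ⊆ solutionsOfInequalities outerInequalities

namespace NestedPolytopeInstance

/-- The inner polytope `A`. -/
def inner (I : NestedPolytopeInstance) : Set (Fin I.n → ℝ) := hullOfPoints I.innerVertices

/-- The outer polytope `B`. -/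
def outer (I : NestedPolytopeInstance) : Set (Fin I.n → ℝ) :=
  solutionsOfInequalities I.outerInequalities

/-- The solutions: the `k`-tuples of points of `ℝⁿ` with `A ⊆ conv (x₁, …, x_k) ⊆ B`. -/
def solutions (I : NestedPolytopeInstance) : Set (Fin I.k → Fin I.n → ℝ) :=
  {x | I.inner ⊆ convexHull ℝ (Set.range x) ∧ convexHull ℝ (Set.range x) ⊆ I.outer}

end NestedPolytopeInstance

set_option linter.unusedSectionVars false

/-! Pick `α` in `F₂` but not in `F₁`. It suffices to build a rational instance in which every
solution has a coordinate equal to a fixed number `γ = (N - α) / c` with `N`, `c` rational, and in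
which some solution uses only rationals and `γ`.

The outer polytope lies over a simplex. Over a simplex vertex `v` its fibre is a square pyramid:
height κ in [0, 1], slope coordinate between `a * κ` and `b * κ`, top coordinate between 0 and κ.
Over a simplex vertex `w` the fibre is a diagonal segment. The inner polytope contains the apex and
the two upper base corners of each pyramid and both ends of each segment; these are vertices of the
outer polytope, so a solution must contain them. It also contains the centre of each base square,
which forces one more point over `v`. With four points allowed per pyramid and two per segment,
exactly one free point per pyramid remains (`exists_range_eq_vertexFamily`).

Further inner points with top coordinate 0 are combinations of free points and segment ends only. A
link target forces two free points to have height 1 and equal slopes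
(`of_linkTarget_mem_convexHull`). A chain target, with coordinates the coefficients of a rational
polynomial Q up to the factor `1 / d`, then says that Q is X + t times another polynomial, where t
is the common slope; hence Q(-t) = 0 (`sum_mul_pow_eq_zero_of_chainTarget_mem`). Since [a, b]
isolates the root, t = γ.

Conversely, convex weights must be nonnegative, so the slope γ is admissible only if the cofactor of
X + γ has nonnegative coefficients. Shifting the minimal polynomial of `α` by a large `N` achieves
this (`exists_nonneg_recursion`). -/

/-! ### Rational affine functions and rational polyhedra -/

/-- A set cut out by finitely many rational linear inequalities, in coordinates indexed by `ι`. -/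
def IsRatPolyhedron {ι : Type*} [Fintype ι] (s : Set (ι → ℝ)) : Prop :=
  ∃ H : Finset ((ι → ℚ) × ℚ), s = {x | ∀ h ∈ H, ∑ i, (h.1 i : ℝ) * x i ≤ (h.2 : ℝ)}

/-- A real function that is affine with rational coefficients. -/
def IsRatAffine {ι : Type*} [Fintype ι] (f : (ι → ℝ) → ℝ) : Prop :=
  ∃ (a : ι → ℚ) (b : ℚ), ∀ x, f x = ∑ i, (a i : ℝ) * x i + (b : ℝ)

namespace IsRatAffine

variable {ι : Type*} [Fintype ι]

theorem const (q : ℚ) : IsRatAffine (fun _ : ι → ℝ => (q : ℝ)) :=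
  ⟨0, q, fun x => by simp⟩

theorem zero : IsRatAffine (fun _ : ι → ℝ => (0 : ℝ)) := by
  simpa using const (ι := ι) 0

theorem one : IsRatAffine (fun _ : ι → ℝ => (1 : ℝ)) := by
  simpa using const (ι := ι) 1

theorem coord (i : ι) : IsRatAffine (fun x : ι → ℝ => x i) := by
  classical
  refine ⟨Pi.single i 1, 0, fun x => ?_⟩
  rw [Finset.sum_eq_single i (fun j _ hj => by simp [hj]) (by simp)]
  simp

theorem add {f g : (ι → ℝ) → ℝ} (hf : IsRatAffine f) (hg : IsRatAffine g) :
    IsRatAffine (fun x => f x + g x) := by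
  obtain ⟨a, b, h⟩ := hf
  obtain ⟨a', b', h'⟩ := hg
  refine ⟨a + a', b + b', fun x => ?_⟩
  simp only [h, h', Pi.add_apply, Rat.cast_add, add_mul, Finset.sum_add_distrib]
  ring

theorem const_mul {f : (ι → ℝ) → ℝ} (q : ℚ) (hf : IsRatAffine f) :
    IsRatAffine (fun x => (q : ℝ) * f x) := by
  obtain ⟨a, b, h⟩ := hf
  refine ⟨q • a, q * b, fun x => ?_⟩
  simp only [h, Pi.smul_apply, smul_eq_mul, Rat.cast_mul, mul_add, Finset.mul_sum, mul_assoc]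

theorem sub {f g : (ι → ℝ) → ℝ} (hf : IsRatAffine f) (hg : IsRatAffine g) :
    IsRatAffine (fun x => f x - g x) := by
  have h := hf.add (hg.const_mul (-1))
  simpa [sub_eq_add_neg] using h

theorem sum {κ : Type*} (s : Finset κ) {f : κ → (ι → ℝ) → ℝ} (hf : ∀ k, IsRatAffine (f k)) :
    IsRatAffine (fun x => ∑ k ∈ s, f k x) := by
  classical
  induction s using Finset.induction_on with
  | empty => simpa using zero
  | insert k s hk ih => simpa [Finset.sum_insert hk] using (hf k).add ih

end IsRatAffine

namespace IsRatPolyhedron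

variable {ι : Type*} [Fintype ι]

theorem univ : IsRatPolyhedron (Set.univ : Set (ι → ℝ)) := ⟨∅, by simp⟩

theorem le {f g : (ι → ℝ) → ℝ} (hf : IsRatAffine f) (hg : IsRatAffine g) :
    IsRatPolyhedron {x | f x ≤ g x} := by
  obtain ⟨a, b, h⟩ := hf.sub hg
  refine ⟨{(a, -b)}, ?_⟩
  ext x
  have := h x
  simp only [Set.mem_ofPred_eq, Finset.mem_singleton, forall_eq, Rat.cast_neg]
  constructor <;> intro h1 <;> linarith

theorem inter {s t : Set (ι → ℝ)} (hs : IsRatPolyhedron s) (ht : IsRatPolyhedron t) :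
    IsRatPolyhedron (s ∩ t) := by
  classical
  obtain ⟨H, rfl⟩ := hs
  obtain ⟨H', rfl⟩ := ht
  refine ⟨H ∪ H', ?_⟩
  ext x
  simp only [Set.mem_inter_iff, Set.mem_ofPred_eq, Finset.mem_union, or_imp, forall_and]

theorem and {p r : (ι → ℝ) → Prop} (hp : IsRatPolyhedron {x | p x})
    (hr : IsRatPolyhedron {x | r x}) : IsRatPolyhedron {x | p x ∧ r x} := hp.inter hr

theorem eq {f g : (ι → ℝ) → ℝ} (hf : IsRatAffine f) (hg : IsRatAffine g) :
    IsRatPolyhedron {x | f x = g x} := by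
  have h := (le hf hg).and (le hg hf)
  simpa only [← le_antisymm_iff] using h

theorem imp {p : (ι → ℝ) → Prop} {c : Prop} (h : c → IsRatPolyhedron {x | p x}) :
    IsRatPolyhedron {x | c → p x} := by
  by_cases hc : c
  · simpa [hc] using h hc
  · simpa [hc] using univ

theorem forall_finite {κ : Type*} [Finite κ] {p : κ → (ι → ℝ) → Prop}
    (h : ∀ k, IsRatPolyhedron {x | p k x}) : IsRatPolyhedron {x | ∀ k, p k x} := by
  classical
  choose H hH using h
  have := Fintype.ofFinite κ
  refine ⟨Finset.univ.biUnion H, ?_⟩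
  ext x
  have h2 : ∀ k, p k x ↔ ∀ h ∈ H k, ∑ i, (h.1 i : ℝ) * x i ≤ (h.2 : ℝ) := fun k => by
    simpa using Set.ext_iff.1 (hH k) x
  simp only [Set.mem_ofPred_eq, h2, Finset.mem_biUnion, Finset.mem_univ, true_and]
  exact ⟨fun h a ⟨k, hk⟩ => h k a hk, fun h k a hk => h a ⟨k, hk⟩⟩

theorem convex {s : Set (ι → ℝ)} (hs : IsRatPolyhedron s) : Convex ℝ s := by
  obtain ⟨H, rfl⟩ := hs
  intro x hx y hy u v hu hv huv h hh
  have h1 := mul_le_mul_of_nonneg_left (hx h hh) hu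
  have h2 := mul_le_mul_of_nonneg_left (hy h hh) hv
  have h3 : ∑ i, (h.1 i : ℝ) * (u • x + v • y) i
      = u * ∑ i, (h.1 i : ℝ) * x i + v * ∑ i, (h.1 i : ℝ) * y i := by
    simp only [Finset.mul_sum, ← Finset.sum_add_distrib]
    exact Finset.sum_congr rfl fun i _ => by simp; ring
  rw [h3]
  calc _ ≤ u * (h.2 : ℝ) + v * (h.2 : ℝ) := add_le_add h1 h2
    _ = h.2 := by rw [← add_mul, huv, one_mul]

end IsRatPolyhedron

/-! ### Reduction to instances in the strict sense -/

/-- Every finite set of rational points contains the vertices of its hull. -/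
theorem exists_irredundant_subset {n : ℕ} (S : Finset (Fin n → ℚ)) :
    ∃ T : Finset (Fin n → ℚ), hullOfPoints T = hullOfPoints S ∧
      ∀ v ∈ T, ratPoint v ∉ hullOfPoints (T.erase v) := by
  induction hc : S.card using Nat.strong_induction_on generalizing S with
  | _ m ih =>
    by_cases h : ∀ v ∈ S, ratPoint v ∉ hullOfPoints (S.erase v)
    · exact ⟨S, rfl, h⟩
    · push Not at h
      obtain ⟨v, hv, hmem⟩ := h
      obtain ⟨T, hT, hT'⟩ := ih _ (hc ▸ Finset.card_erase_lt_of_mem hv) (S.erase v) rfl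
      refine ⟨T, hT.trans (le_antisymm ?_ ?_), hT'⟩
      · exact convexHull_mono (Set.image_mono (by simp))
      · refine convexHull_min ?_ (convex_convexHull ℝ _)
        rintro _ ⟨w, hw, rfl⟩
        by_cases hwv : w = v
        · exact hwv ▸ hmem
        · exact subset_convexHull ℝ _ ⟨w, by simpa [hwv] using hw, rfl⟩

/-- A nested polytope problem in coordinates indexed by any finite type, with any finite list of
points spanning the inner polytope, is equivalent to an instance in the strict sense. -/
theorem exists_nestedPolytopeInstance {ι P : Type} [Fintype ι] [Fintype P]
    (S : Finset (ι → ℚ)) {B : Set (ι → ℝ)} (hB : IsRatPolyhedron B)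
    (hbd : Bornology.IsBounded B)
    (hSB : ∀ v ∈ S, (fun i => (v i : ℝ)) ∈ B) :
    ∃ (I : NestedPolytopeInstance) (e : ι ≃ Fin I.n) (e' : P ≃ Fin I.k),
      ∀ x, x ∈ I.solutions ↔
        (∀ v ∈ S, (fun i => (v i : ℝ)) ∈ convexHull ℝ (Set.range fun p i => x (e' p) (e i))) ∧
        ∀ p, (fun i => x (e' p) (e i)) ∈ B := by
  classical
  have hBc := hB.convex
  obtain ⟨H, hH⟩ := hB
  let e := Fintype.equivFin ι
  let e' := Fintype.equivFin P
  let L : (Fin (Fintype.card ι) → ℝ) ≃ₗ[ℝ] (ι → ℝ) := LinearEquiv.funCongrLeft ℝ ℝ e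
  have hL : ∀ y i, L y i = y (e i) := fun y i => rfl
  let S' : Finset (Fin (Fintype.card ι) → ℚ) := S.image fun v => v ∘ e.symm
  have hrat : ∀ v : ι → ℚ, L (ratPoint (v ∘ e.symm)) = fun i => (v i : ℝ) := fun v => by
    ext i; simp [hL, ratPoint]
  let H' : Finset ((Fin (Fintype.card ι) → ℚ) × ℚ) := H.image fun h => (h.1 ∘ e.symm, h.2)
  have hsol : solutionsOfInequalities H' = L ⁻¹' B := by
    ext y
    simp only [solutionsOfInequalities, H', hH, Finset.forall_mem_image, Set.mem_ofPred_eq,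
      Set.mem_preimage, hL]
    refine forall₂_congr fun h _ => ?_
    rw [← e.sum_comp]
    simp
  -- An instance must list true vertices, while `S` may be redundant; only the hull matters for
  -- solutions.
  obtain ⟨T, hT, hT'⟩ := exists_irredundant_subset S'
  have hsub : ∀ C : Set (ι → ℝ), Convex ℝ C →
      (hullOfPoints T ⊆ L ⁻¹' C ↔ ∀ v ∈ S, (fun i => (v i : ℝ)) ∈ C) := by
    intro C hC
    have hC' : Convex ℝ (L ⁻¹' C) := hC.linear_preimage L.toLinearMap
    rw [hT, hullOfPoints, hC'.convexHull_subset_iff]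
    constructor
    · intro h v hv
      rw [← hrat]
      exact h ⟨v ∘ e.symm, by simpa [S'] using ⟨v, hv, rfl⟩, rfl⟩
    · rintro h _ ⟨w, hw, rfl⟩
      obtain ⟨v, hv, rfl⟩ := Finset.mem_image.1 hw
      rw [Set.mem_preimage, hrat]
      exact h v hv
  refine ⟨⟨Fintype.card ι, T, H', Fintype.card P, hT', ?_, ?_⟩, e, e', ?_⟩
  · rw [hsol]
    have : L ⁻¹' B = L.symm '' B := (LinearEquiv.image_symm_eq_preimage L B).symm
    rw [this]
    exact (L.symm.toLinearMap.toContinuousLinearMap.lipschitz).isBounded_image hbd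
  · rw [hsol]
    exact (hsub B hBc).2 hSB
  · intro x
    have hr : (Set.range fun p i => x (e' p) (e i)) = L '' Set.range x := by
      ext z
      constructor
      · rintro ⟨p, rfl⟩
        exact ⟨x (e' p), ⟨_, rfl⟩, rfl⟩
      · rintro ⟨_, ⟨k, rfl⟩, rfl⟩
        exact ⟨e'.symm k, by ext i; simp [hL]⟩
    have hc : convexHull ℝ (Set.range x)
        = L ⁻¹' (convexHull ℝ (Set.range fun p i => x (e' p) (e i))) := by
      have h1 := L.toLinearMap.image_convexHull (Set.range x)
      rw [hr]
      simp only [LinearEquiv.coe_coe] at h1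
      rw [← h1, L.injective.preimage_image]
    change (hullOfPoints T ⊆ convexHull ℝ (Set.range x) ∧
      convexHull ℝ (Set.range x) ⊆ solutionsOfInequalities H') ↔ _
    refine and_congr ?_ ?_
    · rw [hc]
      exact hsub _ (convex_convexHull ℝ _)
    · have hC' : Convex ℝ (L ⁻¹' B) := hBc.linear_preimage L.toLinearMap
      refine (iff_of_eq (congrArg (fun s => convexHull ℝ (Set.range x) ⊆ s) hsol)).trans ?_
      rw [hC'.convexHull_subset_iff, Set.range_subset_iff]
      exact (e'.forall_congr_right (q := fun k => L (x k) ∈ B)).symm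

/-! ### Normalising a real algebraic number -/

open Polynomial in
/-- All Taylor coefficients of a monic real polynomial at a large enough point are nonnegative. -/
theorem Polynomial.Monic.eventually_taylor_coeff_nonneg {L : ℝ[X]} (hL : L.Monic) :
    ∀ᶠ x in Filter.atTop, ∀ j, 0 ≤ (taylor x L).coeff j := by
  have h : ∀ᶠ x in Filter.atTop, ∀ j ∈ Finset.range (L.natDegree + 1),
      0 ≤ (taylor x L).coeff j := by
    rw [Filter.eventually_all_finset]
    intro j hj
    have hj' : j ≤ L.natDegree := by simpa [Nat.lt_succ_iff] using hj
    simp only [taylor_coeff]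
    -- The j-th Taylor coefficient at x is the j-th Hasse derivative at x, a polynomial in x with
    -- positive leading coefficient: it tends to infinity or is a positive constant.
    have hc : (hasseDeriv j L).leadingCoeff = (L.natDegree.choose j : ℝ) := by
      rw [Polynomial.leadingCoeff, natDegree_hasseDeriv, hasseDeriv_coeff, Nat.sub_add_cancel hj',
        hL.coeff_natDegree, mul_one]
    have hpos : 0 < (hasseDeriv j L).leadingCoeff := by
      rw [hc]; exact_mod_cast Nat.choose_pos hj'
    by_cases hdeg : 0 < (hasseDeriv j L).degree
    · exact ((hasseDeriv j L).tendsto_atTop_of_leadingCoeff_nonneg hdeg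
        hpos.le).eventually_ge_atTop 0
    · rw [eq_C_of_degree_le_zero (not_lt.1 hdeg)]
      refine Filter.Eventually.of_forall fun x => ?_
      rw [eq_C_of_degree_le_zero (not_lt.1 hdeg)] at hpos
      simpa using hpos.le
  filter_upwards [h] with x hx j
  by_cases hj : j ∈ Finset.range (L.natDegree + 1)
  · exact hx j hj
  · rw [coeff_eq_zero_of_natDegree_lt]
    rw [natDegree_taylor]
    simpa [Nat.lt_succ_iff] using hj

open Polynomial in
/-- A real algebraic number, after a rational affine change of variable, is pinned down in a
rational interval by a linear recursion with rational data and nonnegative solution. -/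
theorem exists_nonneg_recursion {α : ℝ} (hα : IsAlgebraic ℚ α) :
    ∃ (N c a b : ℚ) (d : ℕ) (q : ℕ → ℚ) (l : ℕ → ℝ) (γ : ℝ), c ≠ 0 ∧ γ = (N - α) / c ∧
      0 < a ∧ a < b ∧ b ≤ 1 ∧ a ≤ γ ∧ γ ≤ b ∧ 0 < d ∧ (∀ j, 0 ≤ l j) ∧ (∀ j, l j ≤ 1) ∧
      (∀ j, d ≤ j → l j = 0) ∧ (q 0 : ℝ) = γ * l 0 ∧
      (∀ j, (q (j + 1) : ℝ) = l j + γ * l (j + 1)) ∧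
      ∀ t : ℝ, a ≤ t → t ≤ b → ∑ i ∈ Finset.range (d + 1), (q i : ℝ) * (-t) ^ i = 0 → t = γ := by
  set P := minpoly ℚ α with hP
  have hmon : P.Monic := minpoly.monic hα.isIntegral
  set PR := P.map (algebraMap ℚ ℝ) with hPR
  have hroot : PR.IsRoot α := by
    rw [IsRoot, hPR, eval_map_algebraMap]; exact minpoly.aeval ℚ α
  set L := PR /ₘ (X - C α) with hL
  have hfac : (X - C α) * L = PR := mul_divByMonic_eq_iff_isRoot.2 hroot
  have hPRm : PR.Monic := hmon.map _
  have hLm : L.Monic := (monic_X_sub_C α).of_mul_monic_left (hfac ▸ hPRm)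
  -- After the shift by `N` the root becomes `α - N < 0`, and the cofactor `T` of the linear factor
  -- has nonnegative coefficients.
  obtain ⟨N, hN1, hN2⟩ := ((tendsto_natCast_atTop_atTop (R := ℝ)).eventually
    (hLm.eventually_taylor_coeff_nonneg.and (Filter.eventually_gt_atTop α))).exists
  set T := taylor (N : ℝ) L with hT
  set p := taylor (N : ℚ) P with hp
  have hpT : p.map (algebraMap ℚ ℝ) = (X + C ((N : ℝ) - α)) * T := by
    rw [hp, map_taylor, ← hPR, ← hfac, taylor_mul]
    simp only [map_natCast, map_sub, taylor_X, taylor_C]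
    congr 1
    ring
  have hp0 : (p.coeff 0 : ℝ) = (N - α) * T.coeff 0 := by
    have := congrArg (fun f => coeff f 0) hpT
    simpa [coeff_map, add_mul] using this
  have hps : ∀ j, (p.coeff (j + 1) : ℝ) = T.coeff j + (N - α) * T.coeff (j + 1) := fun j => by
    have := congrArg (fun f => coeff f (j + 1)) hpT
    simpa [coeff_map, add_mul, coeff_X_mul, -map_sub] using this
  -- Scaling the variable by `c` brings the negated root into (0, 1); dividing by `K` below brings
  -- the cofactor's coefficients below 1.
  obtain ⟨c, hc⟩ := exists_nat_gt ((N : ℝ) - α)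
  have hNα : 0 < (N : ℝ) - α := sub_pos.2 hN2
  have hc0 : (0 : ℝ) < c := hNα.trans hc
  obtain ⟨K, hK⟩ := exists_nat_gt (∑ j ∈ Finset.range (L.natDegree + 1), (c : ℝ) ^ j * T.coeff j)
  have hterm : ∀ j, 0 ≤ (c : ℝ) ^ j * T.coeff j := fun j => mul_nonneg (by positivity) (hN1 j)
  have hK0 : (0 : ℝ) < K := (Finset.sum_nonneg fun j _ => hterm j).trans_lt hK
  have hTz : ∀ j, L.natDegree + 1 ≤ j → T.coeff j = 0 := fun j hj =>
    coeff_eq_zero_of_natDegree_lt (by rw [hT, natDegree_taylor]; omega)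
  set γ := ((N : ℝ) - α) / c with hγ
  have hγ0 : 0 < γ := div_pos hNα hc0
  have hγ1 : γ < 1 := (div_lt_one hc0).2 hc
  have hγc : (N : ℝ) - α = γ * c := by rw [hγ]; field_simp
  have hfin : {t : ℝ | PR.eval (N - c * t) = 0}.Finite := by
    have h1 : {y : ℝ | PR.IsRoot y}.Finite := finite_setOfPred_isRoot hPRm.ne_zero
    refine h1.preimage (f := fun t : ℝ => (N : ℝ) - c * t) ?_
    intro s _ t _ hst
    have : (c : ℝ) * s = c * t := by simpa using hst
    exact mul_left_cancel₀ hc0.ne' this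
  -- The finitely many other roots stay away from `γ`, so rational `a < γ < b` can be chosen inside
  -- (0, 1) with no other root between them.
  have hnhds : ({t : ℝ | PR.eval (N - c * t) = 0} \ {γ})ᶜ ∈ nhds γ :=
    (hfin.subset Set.sdiff_subset).isClosed.isOpen_compl.mem_nhds (by simp)
  obtain ⟨ε, hε, hball⟩ := Metric.mem_nhds_iff.1 hnhds
  obtain ⟨a, ha1, ha2⟩ := exists_rat_btwn (max_lt hγ0 (sub_lt_self γ hε))
  obtain ⟨b, hb1, hb2⟩ := exists_rat_btwn (lt_min hγ1 (lt_add_of_pos_right γ hε))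
  rw [max_lt_iff] at ha1
  rw [lt_min_iff] at hb2
  -- With `q i = c ^ i * p.coeff i / (c * K)` the generating polynomial of `q` is p(cX) / (cK),
  -- which factors as X + γ times T(cX) / K.
  have hsum : ∀ t : ℝ, ∑ i ∈ Finset.range (L.natDegree + 1 + 1),
      (((c : ℚ) ^ i * p.coeff i / (c * K) : ℚ) : ℝ) * (-t) ^ i
        = PR.eval (N - c * t) / (c * K) := by
    intro t
    have h1 : PR.eval (N - c * t) = (p.map (algebraMap ℚ ℝ)).eval (-(c * t)) := by
      rw [hp, map_taylor, taylor_eval, ← hPR, map_natCast, sub_eq_neg_add]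
    have h2 : (p.map (algebraMap ℚ ℝ)).natDegree < L.natDegree + 1 + 1 := by
      rw [hp, map_taylor, natDegree_taylor, ← hPR, ← hfac, natDegree_mul (X_sub_C_ne_zero α)
        hLm.ne_zero, natDegree_X_sub_C]
      omega
    rw [h1, eval_eq_sum_range' h2, Finset.sum_div]
    refine Finset.sum_congr rfl fun i _ => ?_
    simp only [coeff_map, eq_ratCast]
    push_cast
    rw [show -((c : ℝ) * t) = c * (-t) by ring, mul_pow]
    ring
  refine ⟨N, c, a, b, L.natDegree + 1, fun i => (c : ℚ) ^ i * p.coeff i / (c * K),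
    fun j => (c : ℝ) ^ j * T.coeff j / K, γ, ?_, ?_, ?_, ?_, ?_, ha2.le, hb1.le,
    Nat.succ_pos _, ?_, ?_, ?_, ?_, ?_, ?_⟩
  · exact_mod_cast hc0.ne'
  · simp [hγ]
  · exact_mod_cast ha1.1
  · exact_mod_cast ha2.trans hb1
  · exact_mod_cast hb2.1.le
  · exact fun j => div_nonneg (hterm j) hK0.le
  · intro j
    rw [div_le_one hK0]
    by_cases hj : j < L.natDegree + 1
    · exact (Finset.single_le_sum (fun i _ => hterm i) (Finset.mem_range.2 hj)).trans hK.le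
    · rw [hTz j (not_lt.1 hj), mul_zero]; exact hK0.le
  · intro j hj
    simp [hTz j hj]
  · push_cast
    rw [hp0, hγc]
    field_simp
  · intro j
    push_cast
    rw [hps, hγc, pow_succ]
    field_simp
  · intro t hat htb h
    rw [hsum, div_eq_zero_iff] at h
    have h0 : PR.eval (N - c * t) = 0 := h.resolve_right (by positivity)
    by_contra hne
    refine hball (a := t) ?_ ⟨h0, hne⟩
    rw [Metric.mem_ball, Real.dist_eq, abs_lt]
    constructor <;> linarith

/-! ### Convex weights and supporting hyperplanes -/

/-- A point of a convex hull of finitely many points is a weighted sum of them. -/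
theorem exists_weights_of_mem_convexHull_range {P E : Type*} [Fintype P] [AddCommGroup E]
    [Module ℝ E] {X : P → E} {z : E} (hz : z ∈ convexHull ℝ (Set.range X)) :
    ∃ ω : P → ℝ, (∀ i, 0 ≤ ω i) ∧ ∑ i, ω i = 1 ∧ ∑ i, ω i • X i = z := by
  classical
  have hC : Convex ℝ {z : E | ∃ ω : P → ℝ, (∀ i, 0 ≤ ω i) ∧ ∑ i, ω i = 1 ∧
      ∑ i, ω i • X i = z} := by
    rintro _ ⟨ω, h0, h1, rfl⟩ _ ⟨ω', h0', h1', rfl⟩ u v hu hv huv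
    refine ⟨u • ω + v • ω', fun i => ?_, ?_, ?_⟩
    · exact add_nonneg (mul_nonneg hu (h0 i)) (mul_nonneg hv (h0' i))
    · simp [Finset.sum_add_distrib, ← Finset.mul_sum, h1, h1', huv]
    · simp [Finset.sum_add_distrib, add_smul, Finset.smul_sum, mul_smul]
  refine convexHull_min ?_ hC hz
  rintro _ ⟨i, rfl⟩
  refine ⟨Pi.single i 1, fun j => ?_, by simp, by simp [Pi.single_apply, ite_smul]⟩
  rw [Pi.single_apply]
  split_ifs <;> norm_num

/-- Among the points that span `z` there is one that lies on every supporting hyperplane through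
`z`, and on which a given functional is at least as large as at `z`. -/
theorem exists_mem_supporting_hyperplanes {P E : Type*} [Fintype P] [AddCommGroup E]
    [Module ℝ E] {X : P → E} {z : E} (hz : z ∈ convexHull ℝ (Set.range X)) (g : E →ₗ[ℝ] ℝ) :
    ∃ i, g z ≤ g (X i) ∧
      ∀ (f : E →ₗ[ℝ] ℝ) (c : ℝ), (∀ j, f (X j) ≤ c) → f z = c → f (X i) = c := by
  obtain ⟨ω, h0, h1, rfl⟩ := exists_weights_of_mem_convexHull_range hz
  have key : ∀ (f : E →ₗ[ℝ] ℝ), ∑ j, ω j * (f (∑ i, ω i • X i) - f (X j)) = 0 := fun f => by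
    simp only [mul_sub, Finset.sum_sub_distrib, ← Finset.sum_mul, h1, one_mul, map_sum, map_smul,
      smul_eq_mul, sub_self]
  -- `g z` is an average, so some point of positive weight reaches it; positive weight also puts
  -- that point on every supporting hyperplane through `z`.
  obtain ⟨i, hi, hg⟩ : ∃ i, 0 < ω i ∧ g (∑ i, ω i • X i) ≤ g (X i) := by
    by_contra! hcon
    have hnn : ∀ j ∈ Finset.univ, 0 ≤ ω j * (g (∑ i, ω i • X i) - g (X j)) := fun j _ => by
      rcases (h0 j).eq_or_lt with h | h
      · simp [← h]
      · exact mul_nonneg h.le (sub_nonneg.2 (hcon j h).le)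
    have hz := (Finset.sum_eq_zero_iff_of_nonneg hnn).1 (key g)
    have hω : ∀ j, ω j = 0 := fun j => by
      by_contra hne
      have hpos := (h0 j).lt_of_ne' hne
      exact (mul_pos hpos (sub_pos.2 (hcon j hpos))).ne' (hz j (Finset.mem_univ j))
    simp [hω] at h1
  refine ⟨i, hg, fun f c hf hc => ?_⟩
  have hk := key f
  rw [hc] at hk
  have hz := (Finset.sum_eq_zero_iff_of_nonneg fun j _ =>
    mul_nonneg (h0 j) (sub_nonneg.2 (hf j))).1 hk i (Finset.mem_univ i)
  rcases mul_eq_zero.1 hz with h | h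
  · exact absurd h hi.ne'
  · linarith

/-! ### Pyramids and segments over a simplex -/

/-- The combinatorial data of a polytope fibred over a simplex, with a square pyramid over each
vertex `v : V` and a segment over each vertex `w : W`. The pyramid over `v` lives in the
coordinates `base v`, `slope v` and `top`; the segment over `w` is a diagonal in the
coordinates `slope (left w)` and `slope (right w)`. -/
structure CellLayout (V W D : Type) where
  /-- the height of the pyramid above its apex -/
  base : V → D
  /-- the direction of the edges that carry a free vertex -/
  slope : V → D
  /-- the other direction of the base squares of the pyramids -/
  top : D
  /-- first end of a link -/
  left : W → V
  /-- second end of a link -/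
  right : W → V
  base_ne_slope : ∀ v, base v ≠ slope v
  base_ne_top : ∀ v, base v ≠ top
  slope_ne_top : ∀ v, slope v ≠ top
  slope_left_ne_slope_right : ∀ w, slope (left w) ≠ slope (right w)
  base_left_ne_slope_right : ∀ w, base (left w) ≠ slope (right w)
  base_right_ne_slope_left : ∀ w, base (right w) ≠ slope (left w)
  base_left_ne_base_right : ∀ w, base (left w) ≠ base (right w)

namespace CellLayout

variable {V W D : Type} [DecidableEq V] [DecidableEq W] [DecidableEq D]

section Points

variable {R : Type*} [Ring R]

/-- The point over the vertex `τ` of the simplex with the given remaining coordinates. -/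
def cellPoint (τ : V ⊕ W) (u : D → R) : (V ⊕ W) ⊕ D → R := Sum.elim (Pi.single τ 1) u

variable (L : CellLayout V W D)

/-- Coordinates of a point of the pyramid over `v`. -/
def varCoords (v : V) (κ s r : R) : D → R :=
  Pi.single (L.base v) κ + Pi.single (L.slope v) s + Pi.single L.top r

/-- Coordinates of the second end of the segment over `w`. -/
def linkCoords (w : W) : D → R :=
  Pi.single (L.slope (L.left w)) 1 + Pi.single (L.slope (L.right w)) 1

@[simp] theorem cellPoint_inl (τ σ : V ⊕ W) (u : D → R) :
    cellPoint τ u (Sum.inl σ) = (Pi.single τ 1 : V ⊕ W → R) σ := rfl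

@[simp] theorem cellPoint_inr (τ : V ⊕ W) (u : D → R) (i : D) :
    cellPoint τ u (Sum.inr i) = u i := rfl

@[simp] theorem varCoords_base (v : V) (κ s r : R) : L.varCoords v κ s r (L.base v) = κ := by
  simp [varCoords, L.base_ne_slope, L.base_ne_top]

@[simp] theorem varCoords_slope (v : V) (κ s r : R) : L.varCoords v κ s r (L.slope v) = s := by
  simp [varCoords, (L.base_ne_slope v).symm, L.slope_ne_top]

@[simp] theorem varCoords_top (v : V) (κ s r : R) : L.varCoords v κ s r L.top = r := by
  simp [varCoords, (L.base_ne_top v).symm, (L.slope_ne_top v).symm]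

theorem varCoords_of_ne {v : V} {i : D} (h1 : i ≠ L.base v) (h2 : i ≠ L.slope v)
    (h3 : i ≠ L.top) (κ s r : R) : L.varCoords v κ s r i = 0 := by
  simp [varCoords, h1, h2, h3]

theorem eq_varCoords {v : V} {u : D → R}
    (h : ∀ i, i ≠ L.base v → i ≠ L.slope v → i ≠ L.top → u i = 0) :
    u = L.varCoords v (u (L.base v)) (u (L.slope v)) (u L.top) := by
  ext i
  by_cases h1 : i = L.base v
  · subst h1; simp
  by_cases h2 : i = L.slope v
  · subst h2; simp
  by_cases h3 : i = L.top
  · subst h3; simp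
  rw [h i h1 h2 h3, L.varCoords_of_ne h1 h2 h3]

@[simp] theorem linkCoords_left (w : W) :
    L.linkCoords w (L.slope (L.left w)) = (1 : R) := by
  simp [linkCoords, L.slope_left_ne_slope_right]

@[simp] theorem linkCoords_right (w : W) :
    L.linkCoords w (L.slope (L.right w)) = (1 : R) := by
  simp [linkCoords, (L.slope_left_ne_slope_right w).symm]

@[simp] theorem linkCoords_top (w : W) : L.linkCoords w L.top = (0 : R) := by
  simp [linkCoords, (L.slope_ne_top _).symm]

theorem linkCoords_of_ne {w : W} {i : D} (h1 : i ≠ L.slope (L.left w))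
    (h2 : i ≠ L.slope (L.right w)) : L.linkCoords w i = (0 : R) := by
  simp [linkCoords, h1, h2]

/-- The prescribed vertices together with one further point over each `v : V`. -/
def vertexFamily (a b : R) (κ s r : V → R) :
    (V × Fin 4) ⊕ (W × Fin 2) → ((V ⊕ W) ⊕ D → R)
  | .inl (v, 0) => cellPoint (.inl v) 0
  | .inl (v, 1) => cellPoint (.inl v) (L.varCoords v 1 a 1)
  | .inl (v, 2) => cellPoint (.inl v) (L.varCoords v 1 b 1)
  | .inl (v, 3) => cellPoint (.inl v) (L.varCoords v (κ v) (s v) (r v))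
  | .inr (w, 0) => cellPoint (.inr w) 0
  | .inr (w, 1) => cellPoint (.inr w) (L.linkCoords w)

theorem vertexFamily_inl (a b : R) (κ s r : V → R) (p : (V × Fin 4) ⊕ (W × Fin 2))
    (τ : V ⊕ W) : L.vertexFamily a b κ s r p (.inl τ)
      = (Pi.single (Sum.map Prod.fst Prod.fst p) 1 : V ⊕ W → R) τ := by
  rcases p with ⟨v, j⟩ | ⟨w, j⟩ <;> fin_cases j <;> rfl

end Points

/-- The apex and the two prescribed corners of a pyramid have equal base and top coordinates, so `r
v < κ v` separates the free point from them. -/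
theorem vertexFamily_injective (L : CellLayout V W D) {a b : ℝ} (hab : a < b) {κ s r : V → ℝ}
    (h : ∀ v, r v < κ v) : Function.Injective (L.vertexFamily a b κ s r) := by
  intro p p' hpp
  have hcell : Sum.map Prod.fst Prod.fst p = (Sum.map Prod.fst Prod.fst p' : V ⊕ W) := by
    have h1 := congrFun hpp (.inl (Sum.map Prod.fst Prod.fst p))
    rw [vertexFamily_inl, vertexFamily_inl, Pi.single_eq_same] at h1
    by_contra hne
    rw [Pi.single_eq_of_ne hne] at h1
    exact one_ne_zero h1
  rcases p with ⟨v, j⟩ | ⟨w, j⟩ <;> rcases p' with ⟨v', j'⟩ | ⟨w', j'⟩ <;>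
    simp only [Sum.map_inl, Sum.map_inr, Sum.inl.injEq, Sum.inr.injEq, reduceCtorEq] at hcell
  · subst hcell
    have hv := h v
    have hb := congrFun hpp (.inr (L.base v))
    have hs := congrFun hpp (.inr (L.slope v))
    have ht := congrFun hpp (.inr L.top)
    fin_cases j <;> fin_cases j' <;> first | rfl | (exfalso; simp [vertexFamily] at hb hs ht <;> linarith)
  · subst hcell
    have hs := congrFun hpp (.inr (L.slope (L.left w)))
    fin_cases j <;> fin_cases j' <;> first | rfl | (exfalso; simp [vertexFamily] at hs)

/-! ### The outer polytope -/

section Outer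

variable [Fintype V] [Fintype W] [Fintype D] (L : CellLayout V W D)

/-- The polytope fibred over the simplex on `V ⊕ W`. -/
def outerBody (a b : ℚ) : Set ((V ⊕ W) ⊕ D → ℝ) :=
  {z | (∀ τ, 0 ≤ z (.inl τ)) ∧ ∑ τ, z (.inl τ) = 1 ∧ (∀ i, 0 ≤ z (.inr i)) ∧
    (∀ i, z (.inr i) ≤ 1) ∧
    (∀ v, (∀ i, i ≠ L.base v → i ≠ L.slope v → i ≠ L.top → z (.inr i) ≤ 1 - z (.inl (.inl v))) ∧
      z (.inr (L.slope v)) ≤ b * z (.inr (L.base v)) + (1 - z (.inl (.inl v))) ∧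
      a * z (.inr (L.base v)) ≤ z (.inr (L.slope v)) + (1 - z (.inl (.inl v))) ∧
      z (.inr L.top) ≤ z (.inr (L.base v)) + (1 - z (.inl (.inl v)))) ∧
    (∀ w, (∀ i, i ≠ L.slope (L.left w) → i ≠ L.slope (L.right w) →
        z (.inr i) ≤ 1 - z (.inl (.inr w))) ∧
      z (.inr (L.slope (L.left w))) ≤
        z (.inr (L.slope (L.right w))) + (1 - z (.inl (.inr w))) ∧
      z (.inr (L.slope (L.right w))) ≤
        z (.inr (L.slope (L.left w))) + (1 - z (.inl (.inr w))))}

theorem isRatPolyhedron_outerBody (a b : ℚ) : IsRatPolyhedron (L.outerBody a b) := by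
  have c := fun i : (V ⊕ W) ⊕ D => IsRatAffine.coord i
  have h := fun τ : V ⊕ W => IsRatAffine.one.sub (c (.inl τ))
  have z := IsRatAffine.zero (ι := (V ⊕ W) ⊕ D)
  have o := IsRatAffine.one (ι := (V ⊕ W) ⊕ D)
  refine .and (.forall_finite fun τ => .le z (c _)) <|
    .and (.eq (.sum _ fun τ => c (.inl τ)) o) <|
    .and (.forall_finite fun i => .le z (c _)) <|
    .and (.forall_finite fun i => .le (c _) o) <|
    .and (.forall_finite fun v => .and ?_ <| .and ?_ <| .and ?_ ?_) <|
    .forall_finite fun w => .and ?_ <| .and ?_ ?_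
  · exact .forall_finite fun i => .imp fun _ => .imp fun _ => .imp fun _ => .le (c _) (h _)
  · exact .le (c _) ((IsRatAffine.const_mul b (c _)).add (h _))
  · exact .le (IsRatAffine.const_mul a (c _)) ((c _).add (h _))
  · exact .le (c _) ((c _).add (h _))
  · exact .forall_finite fun i => .imp fun _ => .imp fun _ => .le (c _) (h _)
  · exact .le (c _) ((c _).add (h _))
  · exact .le (c _) ((c _).add (h _))

variable {L} {a b : ℚ}

theorem inl_le_one {z : (V ⊕ W) ⊕ D → ℝ} (hz : z ∈ L.outerBody a b) (τ : V ⊕ W) :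
    z (.inl τ) ≤ 1 :=
  (Finset.single_le_sum (fun σ _ => hz.1 σ) (Finset.mem_univ τ)).trans_eq hz.2.1

theorem isBounded_outerBody : Bornology.IsBounded (L.outerBody a b) := by
  refine (Metric.isBounded_Icc (0 : (V ⊕ W) ⊕ D → ℝ) 1).subset fun z hz => ⟨?_, ?_⟩
  · rintro (τ | i)
    exacts [hz.1 τ, hz.2.2.1 i]
  · rintro (τ | i)
    exacts [inl_le_one hz τ, hz.2.2.2.1 i]

theorem eq_cellPoint {z : (V ⊕ W) ⊕ D → ℝ} (hz : z ∈ L.outerBody a b) {τ : V ⊕ W}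
    (h : z (.inl τ) = 1) : z = cellPoint τ fun i => z (.inr i) := by
  have h0 : ∀ σ, σ ≠ τ → z (.inl σ) = 0 := by
    have hs := hz.2.1
    rw [← Finset.add_sum_erase _ _ (Finset.mem_univ τ), h, add_eq_left,
      Finset.sum_eq_zero_iff_of_nonneg fun σ _ => hz.1 σ] at hs
    exact fun σ hσ => hs σ (by simp [hσ])
  ext (σ | i)
  · by_cases hσ : σ = τ
    · subst hσ; simp [h]
    · simp [h0 σ hσ, hσ]
  · rfl

/-- Each constraint of a cell carries the slack 1 minus the weight of that cell. Over another
simplex vertex the slack is 1 and the constraint follows from the coordinates lying in [0, 1]; only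
the constraints of the cell `τ` itself remain. -/
theorem cellPoint_mem_outerBody (ha : 0 ≤ a) (ha1 : a ≤ 1) (hb : 0 ≤ b) {τ : V ⊕ W} {u : D → ℝ}
    (h0 : ∀ i, 0 ≤ u i) (h1 : ∀ i, u i ≤ 1)
    (hV : ∀ v, τ = .inl v → (∀ i, i ≠ L.base v → i ≠ L.slope v → i ≠ L.top → u i ≤ 0) ∧
      u (L.slope v) ≤ b * u (L.base v) ∧ a * u (L.base v) ≤ u (L.slope v) ∧
      u L.top ≤ u (L.base v))
    (hW : ∀ w, τ = .inr w → (∀ i, i ≠ L.slope (L.left w) → i ≠ L.slope (L.right w) → u i ≤ 0) ∧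
      u (L.slope (L.left w)) = u (L.slope (L.right w))) :
    cellPoint τ u ∈ L.outerBody a b := by
  have ha' : (0 : ℝ) ≤ a := by exact_mod_cast ha
  have ha1' : (a : ℝ) ≤ 1 := by exact_mod_cast ha1
  have hb' : (0 : ℝ) ≤ b := by exact_mod_cast hb
  refine ⟨fun σ => ?_, by simp, h0, h1, fun v => ?_, fun w => ?_⟩
  · rw [cellPoint_inl, Pi.single_apply]
    split_ifs <;> norm_num
  · by_cases hτ : τ = .inl v
    · obtain ⟨p1, p2, p3, p4⟩ := hV v hτ
      subst hτ
      simpa using ⟨p1, p2, p3, p4⟩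
    · have hne : (.inl v : V ⊕ W) ≠ τ := fun h => hτ h.symm
      simp only [cellPoint_inl, cellPoint_inr, Pi.single_eq_of_ne hne, sub_zero]
      have e1 := mul_nonneg hb' (h0 (L.base v))
      have e2 := mul_le_mul ha1' (h1 (L.base v)) (h0 (L.base v)) zero_le_one
      refine ⟨fun i _ _ _ => h1 i, ?_, ?_, ?_⟩
      · linarith [h1 (L.slope v)]
      · linarith [h0 (L.slope v)]
      · linarith [h1 L.top, h0 (L.base v)]
  · by_cases hτ : τ = .inr w
    · obtain ⟨p1, p2⟩ := hW w hτ
      subst hτ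
      simpa using ⟨p1, p2.le, p2.ge⟩
    · have hne : (.inr w : V ⊕ W) ≠ τ := fun h => hτ h.symm
      simp only [cellPoint_inl, cellPoint_inr, Pi.single_eq_of_ne hne, sub_zero]
      refine ⟨fun i _ _ => h1 i, ?_, ?_⟩
      · linarith [h1 (L.slope (L.left w)), h0 (L.slope (L.right w))]
      · linarith [h1 (L.slope (L.right w)), h0 (L.slope (L.left w))]

theorem varPoint_mem_outerBody (ha : 0 ≤ a) (hb : 0 ≤ b) (ha1 : a ≤ 1) (hb1 : b ≤ 1) {v : V}
    {κ s r : ℝ} (hκ0 : 0 ≤ κ) (hκ : κ ≤ 1) (has : a * κ ≤ s) (hsb : s ≤ b * κ) (hr : 0 ≤ r)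
    (hrκ : r ≤ κ) : cellPoint (.inl v) (L.varCoords v κ s r) ∈ L.outerBody a b := by
  have ha' : (0 : ℝ) ≤ a := by exact_mod_cast ha
  have hb1' : (b : ℝ) ≤ 1 := by exact_mod_cast hb1
  have hs0 : 0 ≤ s := (mul_nonneg ha' hκ0).trans has
  have hs1 : s ≤ 1 := hsb.trans (mul_le_one₀ hb1' hκ0 hκ)
  have hall : ∀ i, 0 ≤ L.varCoords v κ s r i ∧ L.varCoords v κ s r i ≤ 1 := fun i => by
    by_cases h1 : i = L.base v
    · subst h1; simp [hκ0, hκ]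
    by_cases h2 : i = L.slope v
    · subst h2; simp [hs0, hs1]
    by_cases h3 : i = L.top
    · subst h3; simp [hr, hrκ.trans hκ]
    simp [L.varCoords_of_ne h1 h2 h3]
  refine cellPoint_mem_outerBody ha ha1 hb (fun i => (hall i).1) (fun i => (hall i).2)
    (fun v' hv' => ?_) (by simp)
  obtain rfl : v = v' := by simpa using hv'
  simp only [varCoords_base, varCoords_slope, varCoords_top]
  exact ⟨fun i h1 h2 h3 => (L.varCoords_of_ne h1 h2 h3 _ _ _).le, hsb, has, hrκ⟩

theorem linkPoint_mem_outerBody (ha : 0 ≤ a) (hb : 0 ≤ b) (ha1 : a ≤ 1) (w : W) :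
    cellPoint (.inr w) (L.linkCoords w) ∈ L.outerBody a b := by
  have hall : ∀ i, (0 : ℝ) ≤ L.linkCoords w i ∧ L.linkCoords w i ≤ (1 : ℝ) := fun i => by
    by_cases h1 : i = L.slope (L.left w)
    · subst h1; simp
    by_cases h2 : i = L.slope (L.right w)
    · subst h2; simp
    simp [L.linkCoords_of_ne h1 h2]
  refine cellPoint_mem_outerBody ha ha1 hb (fun i => (hall i).1) (fun i => (hall i).2)
    (by simp) (fun w' hw' => ?_)
  obtain rfl : w = w' := by simpa using hw'
  exact ⟨fun i h1 h2 => (L.linkCoords_of_ne h1 h2).le, by simp⟩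

theorem zeroPoint_mem_outerBody (ha : 0 ≤ a) (hb : 0 ≤ b) (ha1 : a ≤ 1) (τ : V ⊕ W) :
    cellPoint τ 0 ∈ L.outerBody a b :=
  cellPoint_mem_outerBody ha ha1 hb (by simp) (by simp) (by simp) (by simp)

end Outer

end CellLayout

namespace CellLayout

variable {V W D : Type} [DecidableEq V] [DecidableEq W] [DecidableEq D] [Fintype V] [Fintype W]
  [Fintype D] {L : CellLayout V W D} {a b : ℚ}

theorem vertexFamily_mem_outerBody (ha : 0 ≤ a) (hab : a ≤ b) (hb1 : b ≤ 1) {κ s r : V → ℝ}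
    (h : ∀ v, cellPoint (.inl v) (L.varCoords v (κ v) (s v) (r v)) ∈ L.outerBody a b)
    (p : (V × Fin 4) ⊕ (W × Fin 2)) : L.vertexFamily (a : ℝ) b κ s r p ∈ L.outerBody a b := by
  have hb := ha.trans hab
  have ha1 := hab.trans hb1
  have hab' : (a : ℝ) ≤ b := by exact_mod_cast hab
  rcases p with ⟨v, j⟩ | ⟨w, j⟩ <;> fin_cases j
  · exact zeroPoint_mem_outerBody ha hb ha1 _
  · exact varPoint_mem_outerBody ha hb ha1 hb1 zero_le_one le_rfl (by simp) (by simpa using hab')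
      zero_le_one le_rfl
  · exact varPoint_mem_outerBody ha hb ha1 hb1 zero_le_one le_rfl (by simpa using hab') (by simp)
      zero_le_one le_rfl
  · exact h v
  · exact zeroPoint_mem_outerBody ha hb ha1 _
  · exact linkPoint_mem_outerBody ha hb ha1 _

/-! ### Vertices that every solution must contain -/

section Forced

variable {P : Type} [Fintype P] {X : P → ((V ⊕ W) ⊕ D → ℝ)}

/-- The weight of `τ` is maximal and all fibre coordinates are minimal at this point. These
supporting hyperplanes meet the outer polytope in this point alone, so a spanning point equals it.
-/
theorem exists_eq_zeroPoint (hX : ∀ p, X p ∈ L.outerBody a b) {τ : V ⊕ W}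
    (h : cellPoint τ 0 ∈ convexHull ℝ (Set.range X)) : ∃ p, X p = cellPoint τ 0 := by
  obtain ⟨p, -, hp⟩ := exists_mem_supporting_hyperplanes h 0
  refine ⟨p, ?_⟩
  have h1 := hp (LinearMap.proj (.inl τ)) 1 (fun j => by exact inl_le_one (hX j) τ) (by simp)
  rw [eq_cellPoint (hX p) h1]
  congr 1
  ext i
  have h2 := hp (-LinearMap.proj (.inr i)) 0 (fun j => by simpa using (hX j).2.2.1 i) (by simp)
  simpa using h2

theorem exists_eq_linkPoint (hX : ∀ p, X p ∈ L.outerBody a b) {w : W}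
    (h : cellPoint (.inr w) (L.linkCoords w) ∈ convexHull ℝ (Set.range X)) :
    ∃ p, X p = cellPoint (.inr w) (L.linkCoords w) := by
  obtain ⟨p, -, hp⟩ := exists_mem_supporting_hyperplanes h 0
  refine ⟨p, ?_⟩
  have h1 := hp (LinearMap.proj (.inl (.inr w))) 1 (fun j => by exact inl_le_one (hX j) _) (by simp)
  have h2 := hp (LinearMap.proj (.inr (L.slope (L.left w)))) 1 (fun j => by exact (hX j).2.2.2.1 _)
    (by simp)
  simp only [LinearMap.coe_proj, Function.eval] at h1 h2
  obtain ⟨q1, q2, q3⟩ := (hX p).2.2.2.2.2 w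
  rw [h1, sub_self, add_zero] at q2 q3
  rw [eq_cellPoint (hX p) h1]
  congr 1
  ext i
  by_cases hi : i = L.slope (L.left w)
  · subst hi; simp [h2]
  by_cases hi' : i = L.slope (L.right w)
  · subst hi'; simp; linarith
  · rw [L.linkCoords_of_ne hi hi']
    have := q1 i hi hi'
    linarith [(hX p).2.2.1 i]

theorem eq_varPoint {z : (V ⊕ W) ⊕ D → ℝ} (hz : z ∈ L.outerBody a b) {v : V}
    (h : z (.inl (.inl v)) = 1) : z = cellPoint (.inl v) (L.varCoords v (z (.inr (L.base v)))
      (z (.inr (L.slope v))) (z (.inr L.top))) := by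
  conv_lhs => rw [eq_cellPoint hz h]
  congr 1
  refine L.eq_varCoords fun i h1 h2 h3 => ?_
  have := (hz.2.2.2.2.1 v).1 i h1 h2 h3
  linarith [hz.2.2.1 i]

/-- Four tight inequalities determine this corner: full weight on `v`, top at most 1, top at most
base, and the lower bound on the slope coordinate. -/
theorem exists_eq_lowPoint (hX : ∀ p, X p ∈ L.outerBody a b) {v : V}
    (h : cellPoint (.inl v) (L.varCoords v 1 (a : ℝ) 1) ∈ convexHull ℝ (Set.range X)) :
    ∃ p, X p = cellPoint (.inl v) (L.varCoords v 1 (a : ℝ) 1) := by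
  obtain ⟨p, -, hp⟩ := exists_mem_supporting_hyperplanes h 0
  refine ⟨p, ?_⟩
  have hv := fun j => (hX j).2.2.2.2.1 v
  have h1 := hp (LinearMap.proj (.inl (.inl v))) 1 (fun j => by exact inl_le_one (hX j) _) (by simp)
  have h2 := hp (LinearMap.proj (.inr L.top)) 1 (fun j => by exact (hX j).2.2.2.1 _) (by simp)
  have h3 := hp (LinearMap.proj (.inr L.top) - LinearMap.proj (.inr (L.base v))
    + LinearMap.proj (.inl (.inl v))) 1 (fun j => by simp; linarith [hv j]) (by simp)
  have h4 := hp ((a : ℝ) • LinearMap.proj (.inr (L.base v)) - LinearMap.proj (.inr (L.slope v))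
    + LinearMap.proj (.inl (.inl v))) 1 (fun j => by simp; linarith [hv j]) (by simp)
  simp at h1 h2 h3 h4
  have hb : X p (.inr (L.base v)) = 1 := by linarith
  rw [hb] at h4
  have hs : X p (.inr (L.slope v)) = a := by linarith
  rw [eq_varPoint (hX p) h1, h2, hb, hs]

theorem exists_eq_highPoint (hX : ∀ p, X p ∈ L.outerBody a b) {v : V}
    (h : cellPoint (.inl v) (L.varCoords v 1 (b : ℝ) 1) ∈ convexHull ℝ (Set.range X)) :
    ∃ p, X p = cellPoint (.inl v) (L.varCoords v 1 (b : ℝ) 1) := by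
  obtain ⟨p, -, hp⟩ := exists_mem_supporting_hyperplanes h 0
  refine ⟨p, ?_⟩
  have hv := fun j => (hX j).2.2.2.2.1 v
  have h1 := hp (LinearMap.proj (.inl (.inl v))) 1 (fun j => by exact inl_le_one (hX j) _) (by simp)
  have h2 := hp (LinearMap.proj (.inr L.top)) 1 (fun j => by exact (hX j).2.2.2.1 _) (by simp)
  have h3 := hp (LinearMap.proj (.inr L.top) - LinearMap.proj (.inr (L.base v))
    + LinearMap.proj (.inl (.inl v))) 1 (fun j => by simp; linarith [hv j]) (by simp)
  have h4 := hp (LinearMap.proj (.inr (L.slope v)) - (b : ℝ) • LinearMap.proj (.inr (L.base v))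
    + LinearMap.proj (.inl (.inl v))) 1 (fun j => by simp; linarith [hv j]) (by simp)
  simp at h1 h2 h3 h4
  have hb : X p (.inr (L.base v)) = 1 := by linarith
  rw [hb] at h4
  have hs : X p (.inr (L.slope v)) = b := by linarith
  rw [eq_varPoint (hX p) h1, h2, hb, hs]

/-- The difference of base and top is 1/2 at the middle point, so a spanning point over `v` has a
positive difference, unlike the apex and the two prescribed corners. -/
theorem exists_free_point (hX : ∀ p, X p ∈ L.outerBody a b) {v : V} {s : ℝ}
    (h : cellPoint (.inl v) (L.varCoords v 1 s (1 / 2)) ∈ convexHull ℝ (Set.range X)) :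
    ∃ p, X p (.inl (.inl v)) = 1 ∧ X p (.inr L.top) < X p (.inr (L.base v)) := by
  obtain ⟨p, hg, hp⟩ := exists_mem_supporting_hyperplanes h
    (LinearMap.proj (.inr (L.base v)) - LinearMap.proj (.inr L.top))
  refine ⟨p, ?_, ?_⟩
  · simpa using hp (LinearMap.proj (.inl (.inl v))) 1 (fun j => by exact inl_le_one (hX j) _) (by simp)
  · simp at hg
    linarith

/-- The points of the inner polytope over the vertices of the simplex leave no freedom except for
the position of one point over each `v : V`. -/
theorem exists_range_eq_vertexFamily (hab : a < b)
    {X : (V × Fin 4) ⊕ (W × Fin 2) → ((V ⊕ W) ⊕ D → ℝ)} (hX : ∀ p, X p ∈ L.outerBody a b)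
    (hzero : ∀ τ, cellPoint τ 0 ∈ convexHull ℝ (Set.range X))
    (hlow : ∀ v, cellPoint (.inl v) (L.varCoords v 1 (a : ℝ) 1) ∈ convexHull ℝ (Set.range X))
    (hhigh : ∀ v, cellPoint (.inl v) (L.varCoords v 1 (b : ℝ) 1) ∈ convexHull ℝ (Set.range X))
    (hmid : ∀ v, cellPoint (.inl v) (L.varCoords v 1 (((a + b) / 2 : ℚ) : ℝ) (1 / 2)) ∈
      convexHull ℝ (Set.range X))
    (hlink : ∀ w, cellPoint (.inr w) (L.linkCoords w) ∈ convexHull ℝ (Set.range X)) :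
    ∃ f : V → (V × Fin 4) ⊕ (W × Fin 2), (∀ v, X (f v) (.inl (.inl v)) = 1) ∧
      Set.range X = Set.range (L.vertexFamily (a : ℝ) b (fun v => X (f v) (.inr (L.base v)))
        (fun v => X (f v) (.inr (L.slope v))) (fun v => X (f v) (.inr L.top))) := by
  choose f hf hlt using fun v => exists_free_point hX (hmid v)
  refine ⟨f, hf, ?_⟩
  set Y := L.vertexFamily (a : ℝ) b (fun v => X (f v) (.inr (L.base v)))
    (fun v => X (f v) (.inr (L.slope v))) (fun v => X (f v) (.inr L.top)) with hY
  have hinj : Function.Injective Y :=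
    L.vertexFamily_injective (by exact_mod_cast hab) hlt
  have hex : ∀ p, ∃ i, X i = Y p := by
    rintro (⟨v, j⟩ | ⟨w, j⟩) <;> fin_cases j
    · exact exists_eq_zeroPoint hX (hzero _)
    · exact exists_eq_lowPoint hX (hlow v)
    · exact exists_eq_highPoint hX (hhigh v)
    · exact ⟨f v, eq_varPoint (hX _) (hf v)⟩
    · exact exists_eq_zeroPoint hX (hzero _)
    · exact exists_eq_linkPoint hX (hlink w)
  choose φ hφ using hex
  -- The forced points are distinct and as many as the allowed points, so they exhaust the solution.
  have hφi : Function.Injective φ := fun p p' h => hinj (by rw [← hφ, ← hφ, h])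
  have hXY : X ∘ φ = Y := funext hφ
  rw [← hXY, (Finite.injective_iff_surjective.1 hφi).range_comp]

end Forced

/-! ### Hull membership in terms of free points and link ends -/

theorem sum_points {M : Type*} [AddCommMonoid M] (f : (V × Fin 4) ⊕ (W × Fin 2) → M) :
    ∑ p, f p = ∑ v, (f (.inl (v, 0)) + f (.inl (v, 1)) + f (.inl (v, 2)) + f (.inl (v, 3)))
      + ∑ w, (f (.inr (w, 0)) + f (.inr (w, 1))) := by
  simp [Fintype.sum_sum_type, Fintype.sum_prod_type, Fin.sum_univ_four]

/-- A point of the hull with vanishing `top` coordinate is a combination of the free points and of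
the ends of the links. -/
theorem exists_coeffs_of_mem_convexHull {a b : ℝ} {κ s r : V → ℝ} (hr : ∀ v, 0 ≤ r v)
    {z : (V ⊕ W) ⊕ D → ℝ} (hz : z ∈ convexHull ℝ (Set.range (L.vertexFamily a b κ s r)))
    (htop : z (.inr L.top) = 0) :
    ∃ (l : V → ℝ) (β : W → ℝ), (∀ v, 0 ≤ l v ∧ l v ≤ z (.inl (.inl v))) ∧
      (∀ w, 0 ≤ β w ∧ β w ≤ z (.inl (.inr w))) ∧
      ∀ i, z (.inr i) = ∑ v, l v * L.varCoords v (κ v) (s v) (r v) i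
        + ∑ w, β w * L.linkCoords w i := by
  obtain ⟨ω, h0, -, rfl⟩ := exists_weights_of_mem_convexHull_range hz
  -- No spanning point has a negative top coordinate, and the two prescribed corners have top
  -- coordinate 1, so they get weight 0.
  have htop0 : ∀ v, ω (.inl (v, 1)) = 0 ∧ ω (.inl (v, 2)) = 0 := by
    have h : ∑ v, (ω (.inl (v, 1)) + ω (.inl (v, 2)) + ω (.inl (v, 3)) * r v) = 0 := by
      rw [Finset.sum_apply, sum_points] at htop
      simpa [vertexFamily] using htop
    have hnn : ∀ v, 0 ≤ ω (.inl (v, 3)) * r v := fun v => mul_nonneg (h0 _) (hr v)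
    rw [Finset.sum_eq_zero_iff_of_nonneg fun v _ =>
      add_nonneg (add_nonneg (h0 _) (h0 _)) (hnn v)] at h
    intro v
    have := h v (Finset.mem_univ v)
    constructor <;> linarith [h0 (.inl (v, 1)), h0 (.inl (v, 2)), hnn v]
  refine ⟨fun v => ω (.inl (v, 3)), fun w => ω (.inr (w, 1)), fun v => ⟨h0 _, ?_⟩,
    fun w => ⟨h0 _, ?_⟩, fun i => ?_⟩
  · rw [Finset.sum_apply, sum_points]
    simp [vertexFamily, Pi.single_apply, Finset.sum_add_distrib, htop0, h0]
  · rw [Finset.sum_apply, sum_points]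
    simp [vertexFamily, Pi.single_apply, Finset.sum_add_distrib, h0]
  · rw [Finset.sum_apply, sum_points]
    simp [vertexFamily, htop0]

/-- Combinations of the free points and of the ends of the links lie in the hull. -/
theorem mem_convexHull_of_coeffs {a b : ℝ} {κ s r : V → ℝ} {m : V ⊕ W → ℝ} (hm : ∑ τ, m τ = 1)
    {l : V → ℝ} {β : W → ℝ} (hl : ∀ v, 0 ≤ l v ∧ l v ≤ m (.inl v))
    (hβ : ∀ w, 0 ≤ β w ∧ β w ≤ m (.inr w)) {u : D → ℝ}
    (hu : ∀ i, u i = ∑ v, l v * L.varCoords v (κ v) (s v) (r v) i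
      + ∑ w, β w * L.linkCoords w i) :
    Sum.elim m u ∈ convexHull ℝ (Set.range (L.vertexFamily a b κ s r)) := by
  -- Weight of a cell not used by its free point or link end goes to its zero point, which leaves
  -- the fibre coordinates unchanged.
  let ω : (V × Fin 4) ⊕ (W × Fin 2) → ℝ := Sum.elim
    (fun p => ![m (.inl p.1) - l p.1, 0, 0, l p.1] p.2)
    (fun p => ![m (.inr p.1) - β p.1, β p.1] p.2)
  refine mem_convexHull_of_exists_fintype ω (L.vertexFamily a b κ s r) ?_ ?_
    (fun p => ⟨p, rfl⟩) ?_
  · rintro (⟨v, j⟩ | ⟨w, j⟩) <;> fin_cases j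
    · exact sub_nonneg.2 (hl v).2
    · exact le_rfl
    · exact le_rfl
    · exact (hl v).1
    · exact sub_nonneg.2 (hβ w).2
    · exact (hβ w).1
  · rw [sum_points, ← hm, Fintype.sum_sum_type]
    simp [ω]
  · ext ((v | w) | i) <;> rw [Finset.sum_apply, sum_points]
    · simp [ω, vertexFamily, Pi.single_apply, Finset.sum_add_distrib]
    · simp [ω, vertexFamily, Pi.single_apply, Finset.sum_add_distrib]
    · simp [ω, vertexFamily, hu]

/-- The middle point over `v` lies in the hull as soon as the free point over `v` has a suitable
slope. -/
theorem midPoint_mem_convexHull {a b γ : ℝ} (hab : a < b) (haγ : a ≤ γ) (hγb : γ ≤ b) (v : V) :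
    cellPoint (.inl v) (L.varCoords v 1 ((a + b) / 2) (1 / 2)) ∈
      convexHull ℝ (Set.range (L.vertexFamily (W := W) a b (fun _ => 1) (fun _ => γ) fun _ => 0)) := by
  have hba : 0 < b - a := sub_pos.2 hab
  have hμ : (γ - a) / (2 * (b - a)) ≤ 1 / 2 := by
    rw [div_le_div_iff₀ (by positivity) two_pos]; linarith
  -- The middle point is halfway between the free point of slope `γ` and its reflection, the point
  -- of slope `a + b - γ` on the top edge; the first two weights express half of that reflection by
  -- the two corners.
  refine mem_convexHull_of_exists_fintype
    ![(γ - a) / (2 * (b - a)), 1 / 2 - (γ - a) / (2 * (b - a)), 1 / 2]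
    (fun j : Fin 3 => L.vertexFamily a b (fun _ => 1) (fun _ => γ) (fun _ => 0)
      (.inl (v, j.succ))) ?_ ?_ (fun j => ⟨_, rfl⟩) ?_
  · intro j
    fin_cases j
    · exact div_nonneg (sub_nonneg.2 haγ) (by positivity)
    · exact sub_nonneg.2 hμ
    · simp
  · simp [Fin.sum_univ_three]; norm_num
  · have e0 : L.vertexFamily a b (fun _ => 1) (fun _ => γ) (fun _ => 0) (.inl (v, Fin.succ 0))
        = cellPoint (.inl v) (L.varCoords v 1 a 1) := rfl
    have e1 : L.vertexFamily a b (fun _ => 1) (fun _ => γ) (fun _ => 0) (.inl (v, Fin.succ 1))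
        = cellPoint (.inl v) (L.varCoords v 1 b 1) := rfl
    have e2 : L.vertexFamily a b (fun _ => 1) (fun _ => γ) (fun _ => 0) (.inl (v, Fin.succ 2))
        = cellPoint (.inl v) (L.varCoords v 1 γ 0) := rfl
    rw [Fin.sum_univ_three, e0, e1, e2]
    ext (τ | i)
    · simp [← add_mul]; norm_num
    · by_cases h1 : i = L.base v
      · subst h1; simp; norm_num
      by_cases h2 : i = L.slope v
      · subst h2; simp; field_simp; ring
      by_cases h3 : i = L.top
      · subst h3; simp
      simp [L.varCoords_of_ne h1 h2 h3]

end CellLayout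

/-! ### Link targets and chain targets -/

namespace CellLayout

variable {V W D : Type} [DecidableEq V] [DecidableEq W] [DecidableEq D]

/-- The point that forces the free points over the two ends of the link `w` to have the same
slope. -/
def linkTarget {R : Type*} [DivisionRing R] (L : CellLayout V W D) (w : W) :
    (V ⊕ W) ⊕ D → R :=
  Sum.elim (Sum.elim (Pi.single (L.left w) (1 / 3) + Pi.single (L.right w) (1 / 3))
      (Pi.single w (1 / 3)))
    (Pi.single (L.base (L.left w)) (1 / 3) + Pi.single (L.base (L.right w)) (1 / 3)
      + Pi.single (L.slope (L.left w)) (1 / 3) + Pi.single (L.slope (L.right w)) (1 / 3))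

theorem ratCast_single {ι : Type*} [DecidableEq ι] (i j : ι) (c : ℚ) :
    (((Pi.single i c : ι → ℚ) j : ℚ) : ℝ) = (Pi.single i (c : ℝ) : ι → ℝ) j := by
  by_cases h : j = i
  · subst h; simp
  · simp [h]

theorem ratCast_linkTarget (L : CellLayout V W D) (w : W) (i : (V ⊕ W) ⊕ D) :
    ((L.linkTarget w i : ℚ) : ℝ) = L.linkTarget w i := by
  rcases i with (v | w') | i <;> simp [linkTarget, ratCast_single]

theorem ratCast_vertexFamily (L : CellLayout V W D) (a b : ℚ) (κ s r : V → ℚ)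
    (p : (V × Fin 4) ⊕ (W × Fin 2)) (i : (V ⊕ W) ⊕ D) :
    ((L.vertexFamily a b κ s r p i : ℚ) : ℝ)
      = L.vertexFamily (a : ℝ) b (fun v => (κ v : ℝ)) (fun v => (s v : ℝ)) (fun v => (r v : ℝ))
        p i := by
  rcases i with τ | i
  · simp [vertexFamily_inl, ratCast_single]
  · rcases p with ⟨v, j⟩ | ⟨w, j⟩ <;> fin_cases j <;>
      simp [vertexFamily, varCoords, linkCoords, ratCast_single]

variable [Fintype V] [Fintype W] [Fintype D] {L : CellLayout V W D}

theorem left_ne_right (w : W) : L.left w ≠ L.right w := fun h =>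
  L.base_left_ne_base_right w (congrArg L.base h)

/-- A free point at either end has coefficient at most 1/3 and height at most 1, yet the base
coordinate is 1/3, so both bounds are attained. The segment over `w` then adds the same amount to
both slope coordinates, which forces the slopes to agree. -/
theorem of_linkTarget_mem_convexHull {a b : ℝ} {κ s r : V → ℝ} (hr : ∀ v, 0 ≤ r v)
    (hκ : ∀ v, κ v ≤ 1) {w : W}
    (h : L.linkTarget w ∈ convexHull ℝ (Set.range (L.vertexFamily a b κ s r))) :
    κ (L.left w) = 1 ∧ κ (L.right w) = 1 ∧ s (L.left w) = s (L.right w) := by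
  have hlr := L.left_ne_right w
  obtain ⟨l, β, hl, hβ, hu⟩ := exists_coeffs_of_mem_convexHull hr h
    (by simp [linkTarget, (L.base_ne_top _).symm, (L.slope_ne_top _).symm])
  have hu' : ∀ i, (L.linkTarget w (.inr i) : ℝ)
      = l (L.left w) * L.varCoords (L.left w) (κ (L.left w)) (s (L.left w)) (r (L.left w)) i
      + l (L.right w) * L.varCoords (L.right w) (κ (L.right w)) (s (L.right w)) (r (L.right w)) i
      + β w * L.linkCoords w i := by
    intro i
    rw [hu, Fintype.sum_eq_add (L.left w) (L.right w) hlr, Fintype.sum_eq_single w]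
    · intro w' hw'
      have h1 := hβ w'
      simp only [linkTarget, Sum.elim_inl, Sum.elim_inr, Pi.single_eq_of_ne hw'] at h1
      rw [le_antisymm h1.2 h1.1, zero_mul]
    · rintro v ⟨hv1, hv2⟩
      have h1 := hl v
      simp only [linkTarget, Sum.elim_inl, Pi.add_apply, Pi.single_eq_of_ne hv1,
        Pi.single_eq_of_ne hv2, add_zero] at h1
      rw [le_antisymm h1.2 h1.1, zero_mul]
  have n1 := L.base_ne_slope
  have n2 := L.base_ne_top
  have n3 := L.slope_ne_top
  have n4 := L.slope_left_ne_slope_right w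
  have n5 := L.base_left_ne_slope_right w
  have n6 := L.base_right_ne_slope_left w
  have n7 := L.base_left_ne_base_right w
  have e1 := hu' (L.base (L.left w))
  have e2 := hu' (L.base (L.right w))
  have e3 := hu' (L.slope (L.left w))
  have e4 := hu' (L.slope (L.right w))
  rw [L.varCoords_base, L.varCoords_of_ne n7 n5 (n2 _), L.linkCoords_of_ne (n1 _) n5] at e1
  rw [L.varCoords_base, L.varCoords_of_ne n7.symm n6 (n2 _), L.linkCoords_of_ne n6 (n1 _)] at e2
  rw [L.varCoords_slope, L.varCoords_of_ne n6.symm n4 (n3 _), L.linkCoords_left] at e3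
  rw [L.varCoords_slope, L.varCoords_of_ne n5.symm n4.symm (n3 _), L.linkCoords_right] at e4
  have hlL := hl (L.left w)
  have hlR := hl (L.right w)
  simp only [linkTarget, Sum.elim_inl, Pi.add_apply, Pi.single_eq_same,
    Pi.single_eq_of_ne hlr, Pi.single_eq_of_ne hlr.symm] at hlL hlR
  simp [linkTarget, n1, n5, n7] at e1
  simp [linkTarget, n1, n6, n7.symm] at e2
  simp [linkTarget, (n1 _).symm, n4, n6.symm] at e3
  simp [linkTarget, (n1 _).symm, n4.symm, n5.symm] at e4
  have key : ∀ x y : ℝ, 0 ≤ x → x ≤ 1 / 3 → y ≤ 1 → 1 / 3 = x * y → x = 1 / 3 ∧ y = 1 := by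
    intro x y hx0 hx hy hxy
    have h1 := mul_le_mul_of_nonneg_left hy hx0
    have h2 : x = 1 / 3 := by linarith
    subst h2
    exact ⟨rfl, by linarith⟩
  obtain ⟨x1, y1⟩ := key _ _ hlL.1 (by linarith) (hκ (L.left w)) (by linarith)
  obtain ⟨x2, y2⟩ := key _ _ hlR.1 (by linarith) (hκ (L.right w)) (by linarith)
  rw [x1] at e3
  rw [x2] at e4
  exact ⟨y1, y2, by linarith⟩

theorem linkTarget_mem_convexHull {a b γ : ℝ} (h0 : 0 ≤ γ) (h1 : γ ≤ 1) (w : W) :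
    L.linkTarget w ∈ convexHull ℝ
      (Set.range (L.vertexFamily a b (fun _ => 1) (fun _ => γ) fun _ => 0)) := by
  have hs : ∀ (x : D) (c : ℝ) (i : D),
      (Pi.single x c : D → ℝ) i = c * (Pi.single x 1 : D → ℝ) i := fun x c i => by
    simp [Pi.single_apply]
  refine mem_convexHull_of_coeffs
    -- The free points contribute `γ / 3` to each slope coordinate; the link end supplies the
    -- missing `(1 - γ) / 3`.
    (l := Pi.single (L.left w) (1 / 3) + Pi.single (L.right w) (1 / 3))
    (β := Pi.single w ((1 - γ) / 3)) ?_ (fun v => ⟨?_, le_rfl⟩) (fun w' => ?_) fun i => ?_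
  · rw [Fintype.sum_sum_type]
    simp [Finset.sum_add_distrib]
    norm_num
  · simp only [Pi.add_apply, Pi.single_apply]
    split_ifs <;> norm_num
  · simp only [Sum.elim_inr, Pi.single_apply]
    split_ifs
    · constructor <;> linarith
    · simp
  · have e1 : ∑ v, (Pi.single (L.left w) (1 / 3) + Pi.single (L.right w) (1 / 3) : V → ℝ) v
        * L.varCoords v 1 γ 0 i
        = 1 / 3 * L.varCoords (L.left w) 1 γ 0 i + 1 / 3 * L.varCoords (L.right w) 1 γ 0 i := by
      simp [add_mul, Finset.sum_add_distrib, Pi.single_apply, ite_mul]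
    have e2 : ∑ w', (Pi.single w ((1 - γ) / 3) : W → ℝ) w' * L.linkCoords w' i
        = (1 - γ) / 3 * L.linkCoords w i := by
      simp [Pi.single_apply, ite_mul]
    rw [e1, e2]
    simp only [varCoords, linkCoords, Pi.add_apply]
    rw [hs (L.base _) (1 / 3), hs (L.base (L.right w)) (1 / 3), hs (L.slope (L.left w)) (1 / 3),
      hs (L.slope (L.right w)) (1 / 3), hs (L.slope (L.left w)) γ, hs (L.slope (L.right w)) γ]
    simp
    ring

/-- The layout for a recursion of length `d`: the pyramids over `some j` share coordinates along a
chain, and all of them are linked to the pyramid over `none`. -/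
def chain (d : ℕ) : CellLayout (Option (Fin d)) (Fin d) (Fin (d + 1) ⊕ Fin 3) where
  base v := v.elim (.inr 0) fun j => .inl j.succ
  slope v := v.elim (.inr 1) fun j => .inl j.castSucc
  top := .inr 2
  left w := some w
  -- Consecutive pyramids of the chain share a coordinate, which a link forbids between its ends;
  -- hence each is linked to one extra pyramid with base and slope coordinates of its own.
  right _ := none
  base_ne_slope v := by cases v <;> simp [Fin.ext_iff]
  base_ne_top v := by cases v <;> simp
  slope_ne_top v := by cases v <;> simp
  slope_left_ne_slope_right w := by simp
  base_left_ne_slope_right w := by simp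
  base_right_ne_slope_left w := by simp
  base_left_ne_base_right w := by simp

/-- The point that makes the common slope of the free points a root of the polynomial with
coefficients `q i` and alternating signs. -/
def chainTarget {R : Type*} [DivisionRing R] (d : ℕ) (q : ℕ → R) :
    (Option (Fin d) ⊕ Fin d) ⊕ (Fin (d + 1) ⊕ Fin 3) → R :=
  Sum.elim (Sum.elim (fun v => v.elim 0 fun _ => 1 / d) 0) (Sum.elim (fun i => q i / d) 0)

theorem ratCast_chainTarget (d : ℕ) (q : ℕ → ℚ) (i) :
    ((chainTarget d q i : ℚ) : ℝ) = chainTarget d (fun i => (q i : ℝ)) i := by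
  rcases i with ((_ | v) | w) | (i | i) <;> simp [chainTarget]

theorem chain_varCoords_some {d : ℕ} (j : Fin d) (κ s r : ℝ) (i : Fin (d + 1)) :
    (chain d).varCoords (some j) κ s r (.inl i)
      = (if i = j.succ then κ else 0) + if i = j.castSucc then s else 0 := by
  simp [varCoords, chain, Pi.single_apply]

/-- The free point over `some j` contributes to coordinate `j + 1` with factor 1 and to coordinate
`j` with factor `t`. So the polynomial with coefficients `q i` is a multiple of X + t. -/
theorem sum_mul_pow_eq_zero_of_chainTarget_mem {d : ℕ} (hd : 0 < d) {q : ℕ → ℝ} {a b t : ℝ}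
    {κ s r : Option (Fin d) → ℝ} (hr : ∀ v, 0 ≤ r v) (hκ : ∀ j, κ (some j) = 1)
    (hs : ∀ j, s (some j) = t)
    (h : chainTarget d q ∈ convexHull ℝ (Set.range ((chain d).vertexFamily a b κ s r))) :
    ∑ i ∈ Finset.range (d + 1), q i * (-t) ^ i = 0 := by
  obtain ⟨l, β, hl, hβ, hu⟩ := exists_coeffs_of_mem_convexHull hr h (by simp [chain, chainTarget])
  have hl0 : l none = 0 := le_antisymm (hl none).2 (hl none).1
  have hβ0 : ∀ w, β w = 0 := fun w => le_antisymm (hβ w).2 (hβ w).1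
  have hq : ∀ i : Fin (d + 1), q i
      = d * ∑ j, l (some j) * ((if i = j.succ then 1 else 0) + if i = j.castSucc then t else 0) := by
    intro i
    have h1 := hu (.inl i)
    simp only [Fintype.sum_option, hl0, hβ0, zero_mul, zero_add, Finset.sum_const_zero, add_zero,
      chain_varCoords_some, hκ, hs] at h1
    rw [← h1]
    simp only [chainTarget, Sum.elim_inl, Sum.elim_inr]
    field_simp
  rw [Finset.sum_range]
  simp only [hq, mul_assoc, Finset.sum_mul, ← Finset.mul_sum]
  -- After exchanging the sums each `j` contributes a multiple of `(-t) ^ (j + 1) + t * (-t) ^ j =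
  -- 0`.
  rw [Finset.sum_comm, Finset.sum_eq_zero, mul_zero]
  intro j _
  simp only [← Finset.mul_sum, add_mul, Finset.sum_add_distrib, ite_mul, zero_mul, one_mul,
    Finset.sum_ite_eq', Finset.mem_univ, if_true, Fin.val_succ, Fin.val_castSucc]
  ring

/-- The coefficients `l j / d` serve as weights of the free points: the recursion matches
coordinates, and `0 ≤ l j ≤ 1` keeps each weight within the share `1 / d` of its cell. -/
theorem chainTarget_mem_convexHull {d : ℕ} (hd : 0 < d) {q l : ℕ → ℝ} {a b γ : ℝ}
    (hl0 : ∀ j, 0 ≤ l j) (hl1 : ∀ j, l j ≤ 1) (hld : l d = 0) (hq0 : q 0 = γ * l 0)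
    (hq : ∀ j, q (j + 1) = l j + γ * l (j + 1)) :
    chainTarget d q ∈ convexHull ℝ (Set.range
      ((chain d).vertexFamily a b (fun _ => 1) (fun _ => γ) fun _ => 0)) := by
  have hd' : (0 : ℝ) < d := by exact_mod_cast hd
  refine mem_convexHull_of_coeffs (l := fun v => v.elim 0 fun j => l j / d) (β := 0) ?_ ?_
    (by simp) ?_
  · simp [Fintype.sum_sum_type, Fintype.sum_option, hd'.ne']
  · rintro (_ | j)
    · simp
    · exact ⟨div_nonneg (hl0 _) hd'.le, div_le_div_of_nonneg_right (hl1 _) hd'.le⟩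
  · have hsum : ∀ i : Fin (d + 1), ∑ j : Fin d, l j * (if i = j.castSucc then γ else 0)
        = γ * l i := fun i => by
      -- There is no pyramid with index `d`; since `l d = 0`, the sum may be extended to it.
      have h1 : ∑ j : Fin (d + 1), l j * (if i = j then γ else 0) = γ * l i := by
        simp [mul_comm]
      rw [← h1, Fin.sum_univ_castSucc]
      simp [hld]
    rintro (i | i)
    · simp only [Fintype.sum_option, Option.elim, Pi.zero_apply, zero_mul, zero_add,
        Finset.sum_const_zero, add_zero, chain_varCoords_some, Sum.elim_inl]
      simp only [div_mul_eq_mul_div, ← Finset.sum_div, mul_add, Finset.sum_add_distrib, hsum]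
      refine Fin.cases ?_ (fun k => ?_) i
      · simp [hq0, (Fin.succ_ne_zero _).symm]
      · simp [hq, Fin.succ_inj, add_div]
    · simp only [Fintype.sum_option, Option.elim, Pi.zero_apply, zero_mul, zero_add,
        Finset.sum_const_zero, add_zero, Sum.elim_inr]
      refine (Finset.sum_eq_zero fun j _ => ?_).symm
      simp [varCoords, chain]

end CellLayout

/-! ### The instance and its solutions -/

open CellLayout in
theorem mainTheorem6 (F₁ F₂ : IntermediateField ℚ ℝ)
    (hF₁ : Algebra.IsAlgebraic ℚ F₁) (hF₂ : Algebra.IsAlgebraic ℚ F₂) (hlt : F₁ < F₂) :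
    ∃ I : NestedPolytopeInstance,
      (∃ x ∈ I.solutions, ∀ i j, x i j ∈ F₂) ∧
      ¬ ∃ x ∈ I.solutions, ∀ i j, x i j ∈ F₁ := by
  classical
  obtain ⟨α, hα₂, hα₁⟩ := SetLike.exists_of_lt hlt
  have hα : IsAlgebraic ℚ α := by
    have h := hF₂.isAlgebraic ⟨α, hα₂⟩
    exact h.algebraMap (A := ℝ)
  obtain ⟨N, c, a, b, d, q, l, γ, hc, hγ, ha, hab, hb1, haγ, hγb, hd, hl0, hl1, hld, hq0, hqs,
    hroot⟩ := exists_nonneg_recursion hα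
  have hc' : (c : ℝ) ≠ 0 := by exact_mod_cast hc
  have ha' : (0 : ℝ) < a := by exact_mod_cast ha
  have hab' : (a : ℝ) < b := by exact_mod_cast hab
  have hb1' : (b : ℝ) ≤ 1 := by exact_mod_cast hb1
  have hrat : ∀ (F : IntermediateField ℚ ℝ) (x : ℚ), (x : ℝ) ∈ F := fun F x => F.algebraMap_mem x
  have hγ₂ : γ ∈ F₂ := hγ ▸ div_mem (sub_mem (hrat _ _) hα₂) (hrat _ _)
  have hγ₁ : γ ∉ F₁ := fun h => hα₁ <| by
    have : α = N - γ * c := by rw [hγ]; field_simp; ring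
    exact this ▸ sub_mem (hrat _ _) (mul_mem h (hrat _ _))
  let L := chain d
  -- The inner points reuse the vertex family with the centre of the base square, of slope `(a + b)
  -- / 2` and top 1/2, in place of the free point.
  let S : Finset ((Option (Fin d) ⊕ Fin d) ⊕ (Fin (d + 1) ⊕ Fin 3) → ℚ) :=
    Finset.univ.image (L.vertexFamily a b (fun _ => 1) (fun _ => (a + b) / 2) fun _ => 1 / 2) ∪
      Finset.univ.image L.linkTarget ∪ {chainTarget d q}
  have hS : ∀ C : Set ((Option (Fin d) ⊕ Fin d) ⊕ (Fin (d + 1) ⊕ Fin 3) → ℝ),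
      (∀ v ∈ S, (fun i => (v i : ℝ)) ∈ C) ↔
        (∀ p, L.vertexFamily (a : ℝ) b (fun _ => 1) (fun _ => ((a + b) / 2 : ℚ))
          (fun _ => 1 / 2) p ∈ C) ∧ (∀ w, L.linkTarget w ∈ C) ∧
          chainTarget d (fun i => (q i : ℝ)) ∈ C := by
    intro C
    simp only [S, Finset.mem_union, Finset.mem_image, Finset.mem_univ, true_and,
      Finset.mem_singleton, or_imp, forall_and, forall_exists_index, forall_apply_eq_imp_iff,
      forall_eq, ratCast_linkTarget, ratCast_chainTarget, ratCast_vertexFamily, and_assoc]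
    simp
  let Y := L.vertexFamily (a : ℝ) b (fun _ => 1) (fun _ => γ) fun _ => 0
  have hYB : ∀ p, Y p ∈ L.outerBody a b := vertexFamily_mem_outerBody ha.le hab.le hb1 fun v =>
    varPoint_mem_outerBody ha.le (ha.trans hab).le (hab.le.trans hb1) hb1 zero_le_one le_rfl
      (by simpa using haγ) (by simpa using hγb) le_rfl zero_le_one
  have hYS : ∀ v ∈ S, (fun i => (v i : ℝ)) ∈ convexHull ℝ (Set.range Y) := by
    rw [hS]
    refine ⟨?_, linkTarget_mem_convexHull (ha'.le.trans haγ) (hγb.trans hb1'),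
      chainTarget_mem_convexHull hd hl0 hl1 (hld d le_rfl) hq0 hqs⟩
    have hsub := subset_convexHull ℝ (Set.range Y)
    rintro (⟨v, j⟩ | ⟨w, j⟩) <;> fin_cases j
    · exact hsub ⟨.inl (v, 0), rfl⟩
    · exact hsub ⟨.inl (v, 1), rfl⟩
    · exact hsub ⟨.inl (v, 2), rfl⟩
    · have := midPoint_mem_convexHull (L := L) hab' haγ hγb v
      simpa [vertexFamily] using this
    · exact hsub ⟨.inr (w, 0), rfl⟩
    · exact hsub ⟨.inr (w, 1), rfl⟩
  have hpoly := L.isRatPolyhedron_outerBody a b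
  have hYhull : convexHull ℝ (Set.range Y) ⊆ L.outerBody a b :=
    convexHull_min (Set.range_subset_iff.2 hYB) hpoly.convex
  obtain ⟨I, e, e', hI⟩ := exists_nestedPolytopeInstance
    (P := (Option (Fin d) × Fin 4) ⊕ (Fin d × Fin 2)) S hpoly isBounded_outerBody
    fun v hv => hYhull (hYS v hv)
  refine ⟨I, ⟨fun k n => Y (e'.symm k) (e.symm n), ?_, ?_⟩, ?_⟩
  · rw [hI]
    simp only [Equiv.symm_apply_apply]
    exact ⟨hYS, hYB⟩
  · have hYF : ∀ p i, Y p i ∈ F₂ := by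
      intro p i
      have hsingle : ∀ {ι : Type} [DecidableEq ι] (x y : ι) (z : ℝ), z ∈ F₂ →
          (Pi.single x z : ι → ℝ) y ∈ F₂ := fun x y z hz => by
        rw [Pi.single_apply]
        split_ifs
        exacts [hz, zero_mem _]
      have hvar : ∀ (v : Option (Fin d)) (κ s r : ℝ) (i : Fin (d + 1) ⊕ Fin 3), κ ∈ F₂ → s ∈ F₂ →
          r ∈ F₂ → L.varCoords v κ s r i ∈ F₂ := fun v κ s r i h1 h2 h3 =>
        add_mem (add_mem (hsingle _ _ _ h1) (hsingle _ _ _ h2)) (hsingle _ _ _ h3)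
      rcases i with τ | i
      · rw [show Y p (.inl τ) = _ from L.vertexFamily_inl _ _ _ _ _ p τ]
        exact hsingle _ _ _ (one_mem _)
      · rcases p with ⟨v, j⟩ | ⟨w, j⟩ <;> fin_cases j
        · exact zero_mem _
        · exact hvar _ _ _ _ _ (one_mem _) (hrat _ _) (one_mem _)
        · exact hvar _ _ _ _ _ (one_mem _) (hrat _ _) (one_mem _)
        · exact hvar _ _ _ _ _ (one_mem _) hγ₂ (zero_mem _)
        · exact zero_mem _
        · exact add_mem (hsingle _ _ _ (one_mem _)) (hsingle _ _ _ (one_mem _))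
    exact fun k n => hYF _ _
  · rintro ⟨x, hx, hxF⟩
    obtain ⟨hxS, hxB⟩ := (hI x).1 hx
    set X : (Option (Fin d) × Fin 4) ⊕ (Fin d × Fin 2) → _ → ℝ :=
      fun p i => x (e' p) (e i)
    obtain ⟨hfam, hlink, hchain⟩ := (hS _).1 hxS
    obtain ⟨f, hf, hrange⟩ := exists_range_eq_vertexFamily (L := L) hab hxB
      (by rintro (v | w); exacts [hfam (.inl (v, 0)), hfam (.inr (w, 0))])
      (fun v => hfam (.inl (v, 1))) (fun v => hfam (.inl (v, 2))) (fun v => hfam (.inl (v, 3)))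
      (fun w => hfam (.inr (w, 1)))
    rw [hrange] at hlink hchain
    have hr : ∀ v, 0 ≤ X (f v) (.inr L.top) := fun v => (hxB (f v)).2.2.1 _
    have hl := fun w => of_linkTarget_mem_convexHull hr (fun v => (hxB (f v)).2.2.2.1 _) (hlink w)
    have h0 := sum_mul_pow_eq_zero_of_chainTarget_mem hd hr (fun j => (hl j).1)
      (t := X (f none) (.inr (L.slope none))) (fun j => (hl j).2.2) hchain
    -- Since `d > 0` there is at least one link, and it forces height 1 over `none`. The pyramid
    -- inequalities then confine the slope to [a, b], where `γ` is the only root.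
    have hbase : X (f none) (.inr (L.base none)) = 1 := (hl ⟨0, hd⟩).2.1
    have hweight : X (f none) (.inl (.inl none)) = 1 := hf none
    have h1 : X (f none) (.inr (L.slope none)) ≤ b * X (f none) (.inr (L.base none))
      + (1 - X (f none) (.inl (.inl none))) := ((hxB (f none)).2.2.2.2.1 none).2.1
    have h2 : a * X (f none) (.inr (L.base none)) ≤ X (f none) (.inr (L.slope none))
      + (1 - X (f none) (.inl (.inl none))) := ((hxB (f none)).2.2.2.2.1 none).2.2.1
    rw [hweight, hbase] at h1 h2
    have hγt := hroot _ (by linarith) (by linarith) h0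
    exact hγ₁ (hγt ▸ hxF _ _)
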